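/- **Setting.** Let $\Omega\subset\mathbb{R}^2$ be a bounded polygonal Lipschitz domain with boundary $\Gamma$ and exterior unit normal $n$ (defined at all boundary points except finitely many corners) and unit tangential vector $t$ along $\Gamma$. Let $\mathcal T$ be a finite regular (conforming) triangulation of $\Omega$ by non-degenerate triangles $T$. Let $\Gamma_{hc},\Gamma_{sc},\Gamma_{ss},\Gamma_{sf}\subset\Gamma$ be disjoint, relatively open (possibly empty) pieces with $\Gamma=\mathrm{closure}(\Gamma_{hc}\cup\Gamma_{sc}\cup\Gamma_{ss}\cup\Gamma_{sf})$ that cover $\Gamma$ up to a set of zero length. Let $\mathbb S$ denote the symmetric real $2\times2$ matrices, $(\cdot,\cdot)$ and $\|\cdot\|$ the $L_2(\Omega)$ inner products and norms (Frobenius product for tensors), $\varepsilon(v)=(\nabla v+\nabla v^{\mathsf T})/2$, and $(v_1,v_2)^\perp=(v_2,-v_1)$. Derivatives are weak ones, $\operatorname{div}$ of a tensor is taken row-wise, and boundary values of $H^1(\Omega;\mathbb R^2)$ functions are traces. Let * $H^1(\mathcal T)$ be the space of scalar $z\in L_2(\Omega)$ with $z|_T\in H^1(T)$ for all $T\in\mathcal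 T$, with piecewise $\operatorname{curl}_{\mathcal T}z=(\nabla_{\mathcal T} z)^\perp$; * $H(\operatorname{div},\mathcal T;\mathbb S)$ be the space of $\tau\in L_2(\Omega;\mathbb S)$ with $\operatorname{div}(\tau|_T)\in L_2(T;\mathbb R^2)$ for all $T\in\mathcal T$, with piecewise divergence $\operatorname{div}_{\mathcal T}\tau$ and norm $\|\tau\|_{\operatorname{div},\mathcal T}=(\|\tau\|^2+\|\operatorname{div}_{\mathcal T}\tau\|^2)^{1/2}$; * $\langle\gamma(v),\tau\rangle_{\mathcal S}:=(\varepsilon(v),\tau)+(v,\operatorname{div}_{\mathcal T}\tau)$ for $v\in H^1(\Omega;\mathbb R^2)$, $\tau\in H(\operatorname{div},\mathcal T;\mathbb S)$; * $\langle\gamma_t(v),z\rangle_{\mathcal S}:=(\operatorname{rot}v,z)-(v,\operatorname{curl}_{\mathcal T}z)$ for $v\in H^1(\Omega;\mathbb R^2)$, $z\in H^1(\mathcal T)$, where $\operatorname{rot}v=\partial_1v_2-\partial_2v_1$; * $H_{nn}(\operatorname{div},\mathcal T;\mathbb S):=\{\tau\in H(\operatorname{div},\mathcal T;\mathbb S):\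 \langle\gamma(v),\tau\rangle_{\mathcal S}=0\ \text{for all } v\in H^1_0(\Omega;\mathbb R^2)\text{ with }\gamma_t(v)=0\}$ (tensors with continuous normal-normal traces); * $\gamma_{1,nn}(v)\in H_{nn}(\operatorname{div},\mathcal T;\mathbb S)^*$ be the restriction of the functional $\gamma(v)$ to $H_{nn}(\operatorname{div},\mathcal T;\mathbb S)$, for $v\in H^1(\Omega;\mathbb R^2)$; * $H^1_D(\Omega;\mathbb R^2):=\{v\in H^1(\Omega;\mathbb R^2):\ v|_{\Gamma_{hc}}=0,\ v\cdot n|_{\Gamma_{sc}}=0,\ v\cdot t|_{\Gamma_{ss}}=0\}$; * $H^{1/2}_t(\mathcal S;\mathbb R^2):=\gamma_{1,nn}(H^1(\Omega;\mathbb R^2))$ and $H^{1/2}_{D,t}(\mathcal S;\mathbb R^2):=\gamma_{1,nn}(H^1_D(\Omega;\mathbb R^2))$; * $\|\rho\|_{1/2,t,\mathcal S}:=\inf\{(\|v\|^2+\|\varepsilon(v)\|^2)^{1/2}:\ v\in H^1(\Omega;\mathbb R^2),\ \gamma_{1,nn}(v)=\rho\}$ for $\rho\in H^{1/2}_t(\mathcal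 S;\mathbb R^2)$ (minimal extension norm). For $\rho\in H^{1/2}_t(\mathcal S;\mathbb R^2)$ and $\tau\in H_{nn}(\operatorname{div},\mathcal T;\mathbb S)$ write $\langle\rho,\tau\rangle_{\mathcal S}:=\rho(\tau)$. **Proposition.** Any $\rho\in H^{1/2}_t(\mathcal S;\mathbb R^2)$ satisfies $$\|\rho\|_{1/2,t,\mathcal S}=\sup_{0\ne\tau\in H_{nn}(\operatorname{div},\mathcal T;\mathbb S)}\frac{\langle\rho,\tau\rangle_{\mathcal S}}{\|\tau\|_{\operatorname{div},\mathcal T}}.$$ If $\Gamma_{ss}\cup\Gamma_{sf}=\emptyset$ and $\rho\in H^{1/2}_{D,t}(\mathcal S;\mathbb R^2)$, then the same relation holds with the supremum taken over all $\tau\in H_{nn}(\operatorname{div},\mathcal T;\mathbb S)\setminus\{0\}$ with $\int_\Omega\operatorname{tr}(\tau)\,dx=0$. -/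

import Mathlib

open MeasureTheory Set Metric
open scoped ContDiff ENNReal

noncomputable section

namespace Elast

/-! ### Values: vectors and tensors -/

/-- Points and vectors of the Euclidean plane. -/
abbrev Vec : Type := EuclideanSpace ℝ (Fin 2)

/-- Real `2 × 2` tensors, entries indexed by `(row, column)`, with the Frobenius inner product. -/
abbrev Mat : Type := EuclideanSpace ℝ (Fin 2 × Fin 2)

/-- The transpose of a tensor. -/
def transposeL : Mat →L[ℝ] Mat :=
  LinearMap.toContinuousLinearMap
    { toFun := fun A => WithLp.toLp 2 (fun p : Fin 2 × Fin 2 => A (p.2, p.1))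
      map_add' := fun _ _ => by ext; simp
      map_smul' := fun _ _ => by ext; simp }

/-- The symmetric part `(A + Aᵀ) / 2`. -/
def symL : Mat →L[ℝ] Mat := (1 / 2 : ℝ) • (ContinuousLinearMap.id ℝ Mat + transposeL)

/-- The trace `A₁₁ + A₂₂`. -/
def trL : Mat →L[ℝ] ℝ :=
  EuclideanSpace.proj ((0, 0) : Fin 2 × Fin 2) + EuclideanSpace.proj ((1, 1) : Fin 2 × Fin 2)

/-- `A₂₁ - A₁₂`; applied to a gradient `∇v` (entries `∂ⱼ vᵢ`) this is `rot v = ∂₁v₂ - ∂₂v₁`. -/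
def rotL : Mat →L[ℝ] ℝ :=
  EuclideanSpace.proj ((1, 0) : Fin 2 × Fin 2) - EuclideanSpace.proj ((0, 1) : Fin 2 × Fin 2)

/-- `v^⊥ = (v₂, -v₁)`. -/
def perpL : Vec →L[ℝ] Vec :=
  LinearMap.toContinuousLinearMap
    { toFun := fun v => !₂[v 1, -v 0]
      map_add' := fun v w => by ext i; fin_cases i <;> simp [add_comm]
      map_smul' := fun c v => by ext i; fin_cases i <;> simp }

/-! ### The domain, its boundary and the mesh -/

/-- A bounded polygonal Lipschitz domain: a bounded, open, connected, non-empty set that is locally,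
after a rigid motion, the region below the graph of a Lipschitz function, and whose boundary is
a finite union of line segments. -/
structure IsPolygonalLipschitzDomain (Ω : Set Vec) : Prop where
  isOpen : IsOpen Ω
  isConnected : IsConnected Ω
  isBounded : Bornology.IsBounded Ω
  lipschitz : ∀ x ∈ frontier Ω, ∃ r > 0, ∃ L : Vec ≃ₗᵢ[ℝ] Vec, ∃ c : NNReal, ∃ f : ℝ → ℝ,
    LipschitzWith c f ∧ ∀ y ∈ ball x r, y ∈ Ω ↔ (L y) 1 < f ((L y) 0)
  polygonal : ∃ S : Set (Vec × Vec), S.Finite ∧ frontier Ω = ⋃ p ∈ S, segment ℝ p.1 p.2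

/-- `K` is a regular (conforming) triangulation of `Ω`: a finite simplicial complex, each of whose
vertices and edges belongs to a (non-degenerate) triangle, and whose triangles
cover the closure of `Ω`. -/
structure IsTriangulation (K : Geometry.SimplicialComplex ℝ Vec) (Ω : Set Vec) : Prop where
  finite : K.faces.Finite
  pure : ∀ s ∈ K.faces, ∃ t ∈ K.faces, s ⊆ t ∧ t.card = 3
  space_eq : K.space = closure Ω

/-- The open triangles of the mesh. -/
def openTriangles (K : Geometry.SimplicialComplex ℝ Vec) : Set (Set Vec) :=
  {T | ∃ s ∈ K.faces, s.card = 3 ∧ T = interior (convexHull ℝ (s : Set Vec))}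

/-- `ν` is the exterior unit normal at the boundary point `x` of `Ω`: near `x`, the set `Ω` is the
half-plane with exterior normal `ν`. For a polygonal Lipschitz domain such a `ν` exists (and is
unique) at all boundary points except for finitely many corners. -/
def IsOuterNormal (Ω : Set Vec) (x ν : Vec) : Prop :=
  ‖ν‖ = 1 ∧ ∃ r > 0, ∀ y ∈ ball x r, y ∈ Ω ↔ inner ℝ (y - x) ν < 0

open Classical in
/-- The exterior unit normal field on the boundary of `Ω` (zero where there is none). -/
def outerNormal (Ω : Set Vec) (x : Vec) : Vec :=
  if h : ∃ ν, IsOuterNormal Ω x ν then h.choose else 0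

/-- The boundary of `Ω` is decomposed into disjoint relatively open pieces (hard clamped, soft
clamped, simply supported, stress free), whose closures cover the boundary. The part of the boundary
that is left out has zero length; this holds whenever the pieces have
finitely many connected components. -/
structure IsBoundaryDecomposition (Ω Γhc Γsc Γss Γsf : Set Vec) : Prop where
  hc_open : ∃ U, IsOpen U ∧ Γhc = U ∩ frontier Ω
  sc_open : ∃ U, IsOpen U ∧ Γsc = U ∩ frontier Ω
  ss_open : ∃ U, IsOpen U ∧ Γss = U ∩ frontier Ω
  sf_open : ∃ U, IsOpen U ∧ Γsf = U ∩ frontier Ω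
  disjoint_hc_sc : Disjoint Γhc Γsc
  disjoint_hc_ss : Disjoint Γhc Γss
  disjoint_hc_sf : Disjoint Γhc Γsf
  disjoint_sc_ss : Disjoint Γsc Γss
  disjoint_sc_sf : Disjoint Γsc Γsf
  disjoint_ss_sf : Disjoint Γss Γsf
  closure_eq : closure (Γhc ∪ Γsc ∪ Γss ∪ Γsf) = frontier Ω
  null : Measure.hausdorffMeasure 1 (frontier Ω \ (Γhc ∪ Γsc ∪ Γss ∪ Γsf)) = 0

/-! ### Weak derivatives -/

/-- The space `L₂(Ω; F)`. -/
abbrev L2 (Ω : Set Vec) (F : Type) [NormedAddCommGroup F] : Type :=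
  Lp F 2 (volume.restrict Ω)

/-- `φ ∈ C_c^∞(U)`. -/
def IsTest (U : Set Vec) (φ : Vec → ℝ) : Prop :=
  ContDiff ℝ ∞ φ ∧ HasCompactSupport φ ∧ tsupport φ ⊆ U

/-- The classical partial derivative `∂ⱼ φ`. -/
def pd (j : Fin 2) (φ : Vec → ℝ) (x : Vec) : ℝ := fderiv ℝ φ x (EuclideanSpace.single j 1)

/-- On `U ⊆ Ω` the function `g` is the weak partial derivative `∂ⱼ f`. -/
def IsWeakPartial (Ω U : Set Vec) (j : Fin 2) (f g : Vec → ℝ) : Prop :=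
  ∀ φ, IsTest U φ → ∫ x in Ω, f x * pd j φ x = - ∫ x in Ω, g x * φ x

/-- On `U ⊆ Ω` the function `d` is the weak divergence of the vector field `F`. -/
def IsWeakDiv (Ω U : Set Vec) (F : Fin 2 → Vec → ℝ) (d : Vec → ℝ) : Prop :=
  ∀ φ, IsTest U φ → ∫ x in Ω, (∑ j, F j x * pd j φ x) = - ∫ x in Ω, d x * φ x

section closure_properties

variable {Ω U : Set Vec}

lemma IsTest.memLp {φ : Vec → ℝ} (h : IsTest U φ) : MemLp φ 2 (volume.restrict Ω) :=
  (h.1.continuous.memLp_of_hasCompactSupport h.2.1).restrict Ω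

lemma IsTest.memLp_pd {φ : Vec → ℝ} (h : IsTest U φ) (j : Fin 2) :
    MemLp (pd j φ) 2 (volume.restrict Ω) := by
  have hc : Continuous (pd j φ) :=
    (h.1.continuous_fderiv (by simp)).clm_apply continuous_const
  have hs : HasCompactSupport (pd j φ) := h.2.1.fderiv_apply (𝕜 := ℝ) _
  exact (hc.memLp_of_hasCompactSupport hs).restrict Ω

lemma IsWeakPartial.congr {j : Fin 2} {f g f' g' : Vec → ℝ} (h : IsWeakPartial Ω U j f g)
    (hf : f' =ᵐ[volume.restrict Ω] f) (hg : g' =ᵐ[volume.restrict Ω] g) :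
    IsWeakPartial Ω U j f' g' := by
  intro φ hφ
  have h1 : (fun x => f' x * pd j φ x) =ᵐ[volume.restrict Ω] fun x => f x * pd j φ x := by
    filter_upwards [hf] with x hx
    rw [hx]
  have h2 : (fun x => g' x * φ x) =ᵐ[volume.restrict Ω] fun x => g x * φ x := by
    filter_upwards [hg] with x hx
    rw [hx]
  rw [integral_congr_ae h1, integral_congr_ae h2]
  exact h φ hφ

lemma IsWeakDiv.congr {F F' : Fin 2 → Vec → ℝ} {d d' : Vec → ℝ} (h : IsWeakDiv Ω U F d)
    (hF : ∀ j, F' j =ᵐ[volume.restrict Ω] F j) (hd : d' =ᵐ[volume.restrict Ω] d) :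
    IsWeakDiv Ω U F' d' := by
  intro φ hφ
  have h1 : (fun x => ∑ j, F' j x * pd j φ x) =ᵐ[volume.restrict Ω]
      fun x => ∑ j, F j x * pd j φ x := by
    filter_upwards [hF 0, hF 1] with x h0 h1
    simp [Fin.sum_univ_two, h0, h1]
  have h2 : (fun x => d' x * φ x) =ᵐ[volume.restrict Ω] fun x => d x * φ x := by
    filter_upwards [hd] with x hx
    rw [hx]
  rw [integral_congr_ae h1, integral_congr_ae h2]
  exact h φ hφ

lemma IsWeakDiv.zero : IsWeakDiv Ω U (fun _ _ => 0) (fun _ => 0) := by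
  intro φ _
  simp

lemma IsWeakDiv.add {F F' : Fin 2 → Vec → ℝ} {d d' : Vec → ℝ}
    (h : IsWeakDiv Ω U F d) (h' : IsWeakDiv Ω U F' d')
    (hF : ∀ j, MemLp (F j) 2 (volume.restrict Ω)) (hF' : ∀ j, MemLp (F' j) 2 (volume.restrict Ω))
    (hd : MemLp d 2 (volume.restrict Ω)) (hd' : MemLp d' 2 (volume.restrict Ω)) :
    IsWeakDiv Ω U (fun j x => F j x + F' j x) (fun x => d x + d' x) := by
  intro φ hφ
  have e1 : (fun x => ∑ j, (F j x + F' j x) * pd j φ x) =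
      fun x => (∑ j, F j x * pd j φ x) + ∑ j, F' j x * pd j φ x := by
    ext x; simp only [Fin.sum_univ_two]; ring
  have e2 : (fun x => (d x + d' x) * φ x) = fun x => d x * φ x + d' x * φ x := by
    ext x; ring
  rw [e1, e2, integral_add, integral_add, h φ hφ, h' φ hφ]
  · ring
  · exact hd.integrable_mul hφ.memLp
  · exact hd'.integrable_mul hφ.memLp
  · exact integrable_finsetSum _ fun j _ => (hF j).integrable_mul (hφ.memLp_pd j)
  · exact integrable_finsetSum _ fun j _ => (hF' j).integrable_mul (hφ.memLp_pd j)

lemma IsWeakDiv.smul {F : Fin 2 → Vec → ℝ} {d : Vec → ℝ} (h : IsWeakDiv Ω U F d) (c : ℝ) :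
    IsWeakDiv Ω U (fun j x => c * F j x) (fun x => c * d x) := by
  intro φ hφ
  have e1 : (fun x => ∑ j, c * F j x * pd j φ x) = fun x => c * ∑ j, F j x * pd j φ x := by
    ext x; simp only [Fin.sum_univ_two]; ring
  have e2 : (fun x => c * d x * φ x) = fun x => c * (d x * φ x) := by
    ext x; ring
  rw [e1, e2, integral_const_mul, integral_const_mul, h φ hφ]
  ring

lemma IsWeakPartial.zero {j : Fin 2} : IsWeakPartial Ω U j (fun _ => 0) (fun _ => 0) := by
  intro φ _
  simp

lemma IsWeakPartial.add {j : Fin 2} {f f' g g' : Vec → ℝ}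
    (h : IsWeakPartial Ω U j f g) (h' : IsWeakPartial Ω U j f' g')
    (hf : MemLp f 2 (volume.restrict Ω)) (hf' : MemLp f' 2 (volume.restrict Ω))
    (hg : MemLp g 2 (volume.restrict Ω)) (hg' : MemLp g' 2 (volume.restrict Ω)) :
    IsWeakPartial Ω U j (fun x => f x + f' x) (fun x => g x + g' x) := by
  intro φ hφ
  simp only [add_mul]
  rw [integral_add, integral_add, h φ hφ, h' φ hφ]
  · ring
  · exact hg.integrable_mul hφ.memLp
  · exact hg'.integrable_mul hφ.memLp
  · exact hf.integrable_mul (hφ.memLp_pd j)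
  · exact hf'.integrable_mul (hφ.memLp_pd j)

lemma IsWeakPartial.smul {j : Fin 2} {f g : Vec → ℝ} (h : IsWeakPartial Ω U j f g) (c : ℝ) :
    IsWeakPartial Ω U j (fun x => c * f x) (fun x => c * g x) := by
  intro φ hφ
  simp only [mul_assoc]
  rw [integral_const_mul, integral_const_mul, h φ hφ]
  ring

lemma memLp_coord {ι : Type} [Fintype ι] (f : L2 Ω (EuclideanSpace ℝ ι)) (i : ι) :
    MemLp (fun x => f x i) 2 (volume.restrict Ω) :=
  (EuclideanSpace.proj i : EuclideanSpace ℝ ι →L[ℝ] ℝ).comp_memLp' (Lp.memLp f)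

lemma coord_zero {ι : Type} [Fintype ι] (i : ι) :
    (fun x => (0 : L2 Ω (EuclideanSpace ℝ ι)) x i) =ᵐ[volume.restrict Ω] fun _ => 0 := by
  filter_upwards [Lp.coeFn_zero (EuclideanSpace ℝ ι) 2 (volume.restrict Ω)] with x hx
  rw [hx]
  rfl

lemma coord_add {ι : Type} [Fintype ι] (f g : L2 Ω (EuclideanSpace ℝ ι)) (i : ι) :
    (fun x => (f + g) x i) =ᵐ[volume.restrict Ω] fun x => f x i + g x i := by
  filter_upwards [Lp.coeFn_add f g] with x hx
  rw [hx]
  rfl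

lemma coord_smul {ι : Type} [Fintype ι] (c : ℝ) (f : L2 Ω (EuclideanSpace ℝ ι)) (i : ι) :
    (fun x => (c • f) x i) =ᵐ[volume.restrict Ω] fun x => c * f x i := by
  filter_upwards [Lp.coeFn_smul c f] with x hx
  rw [hx]
  rfl

end closure_properties

/-! ### Function spaces

A function is stored together with its weak derivative, which it determines almost everywhere. -/

/-- `H¹(Ω; ℝ²)`: pairs `(v, ∇v)` of square integrable functions, `(∇v)ᵢⱼ = ∂ⱼ vᵢ` weakly in `Ω`. -/
def H1 (Ω : Set Vec) : Submodule ℝ (WithLp 2 (L2 Ω Vec × L2 Ω Mat)) where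
  carrier := {p | ∀ i j, IsWeakPartial Ω Ω j (fun x => p.fst x i) (fun x => p.snd x (i, j))}
  zero_mem' := fun i j => IsWeakPartial.zero.congr (coord_zero i) (coord_zero (i, j))
  add_mem' := fun {p q} hp hq i j =>
    ((hp i j).add (hq i j) (memLp_coord _ _) (memLp_coord _ _) (memLp_coord _ _)
      (memLp_coord _ _)).congr (coord_add p.fst q.fst i) (coord_add p.snd q.snd (i, j))
  smul_mem' := fun c p hp i j =>
    ((hp i j).smul c).congr (coord_smul c p.fst i) (coord_smul c p.snd (i, j))

/-- The broken space `H¹(𝒯)` of scalar functions: pairs `(z, ∇_𝒯 z)` of square integrable functions,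
the second one being the weak gradient of the first one in each open triangle of the mesh. -/
def H1T (Ω : Set Vec) (K : Geometry.SimplicialComplex ℝ Vec) :
    Submodule ℝ (WithLp 2 (L2 Ω ℝ × L2 Ω Vec)) where
  carrier := {p | ∀ T ∈ openTriangles K, ∀ j,
    IsWeakPartial Ω T j (fun x => p.fst x) (fun x => p.snd x j)}
  zero_mem' := fun _ _ j =>
    IsWeakPartial.zero.congr (Lp.coeFn_zero ℝ 2 (volume.restrict Ω)) (coord_zero j)
  add_mem' := fun {p q} hp hq T hT j =>
    ((hp T hT j).add (hq T hT j) (Lp.memLp _) (Lp.memLp _) (memLp_coord _ _)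
      (memLp_coord _ _)).congr (Lp.coeFn_add p.fst q.fst) (coord_add p.snd q.snd j)
  smul_mem' := fun c p hp T hT j =>
    ((hp T hT j).smul c).congr (Lp.coeFn_smul c p.fst) (coord_smul c p.snd j)

/-- `H(div, 𝒯; 𝕊)`: pairs `(τ, div_𝒯 τ)` of square integrable functions, with `τ` pointwise symmetric
and the second one being the (row-wise) weak divergence of `τ` in each open triangle of the mesh.
The norm inherited from `L₂(Ω; ℝ²ˣ²) × L₂(Ω; ℝ²)` is
`‖τ‖_{div,𝒯} = (‖τ‖² + ‖div_𝒯 τ‖²)^{1/2}`. -/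
def HdivT (Ω : Set Vec) (K : Geometry.SimplicialComplex ℝ Vec) :
    Submodule ℝ (WithLp 2 (L2 Ω Mat × L2 Ω Vec)) where
  carrier := {p | (∀ᵐ x ∂(volume.restrict Ω), ∀ i j, p.fst x (i, j) = p.fst x (j, i)) ∧
    ∀ T ∈ openTriangles K, ∀ i,
      IsWeakDiv Ω T (fun j x => p.fst x (i, j)) (fun x => p.snd x i)}
  zero_mem' := by
    refine ⟨?_, fun _ _ i => IsWeakDiv.zero.congr (fun j => coord_zero (i, j)) (coord_zero i)⟩
    filter_upwards [Lp.coeFn_zero Mat 2 (volume.restrict Ω)] with x hx i j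
    change (0 : L2 Ω Mat) x (i, j) = (0 : L2 Ω Mat) x (j, i)
    rw [hx]
    rfl
  add_mem' := by
    intro p q hp hq
    refine ⟨?_, fun T hT i => ((hp.2 T hT i).add (hq.2 T hT i) (fun _ => memLp_coord _ _)
      (fun _ => memLp_coord _ _) (memLp_coord _ _) (memLp_coord _ _)).congr
      (fun j => coord_add p.fst q.fst (i, j)) (coord_add p.snd q.snd i)⟩
    filter_upwards [hp.1, hq.1, Lp.coeFn_add p.fst q.fst] with x h1 h2 h3 i j
    change (p.fst + q.fst) x (i, j) = (p.fst + q.fst) x (j, i)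
    rw [h3]
    exact congrArg₂ (· + ·) (h1 i j) (h2 i j)
  smul_mem' := by
    intro c p hp
    refine ⟨?_, fun T hT i => ((hp.2 T hT i).smul c).congr
      (fun j => coord_smul c p.fst (i, j)) (coord_smul c p.snd i)⟩
    filter_upwards [hp.1, Lp.coeFn_smul c p.fst] with x h1 h3 i j
    change (c • p.fst) x (i, j) = (c • p.fst) x (j, i)
    rw [h3]
    exact congrArg (c * ·) (h1 i j)

section operators

variable {Ω : Set Vec} {K : Geometry.SimplicialComplex ℝ Vec}

/-- The function `v` itself. -/
def H1.val : H1 Ω →L[ℝ] L2 Ω Vec := (WithLp.fstL 2 ℝ _ _).comp (H1 Ω).subtypeL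

/-- The gradient `∇v`. -/
def H1.grad : H1 Ω →L[ℝ] L2 Ω Mat := (WithLp.sndL 2 ℝ _ _).comp (H1 Ω).subtypeL

/-- The strain `ε(v) = (∇v + ∇vᵀ) / 2`. -/
def H1.strain : H1 Ω →L[ℝ] L2 Ω Mat := (symL.compLpL 2 (volume.restrict Ω)).comp H1.grad

/-- `rot v = ∂₁v₂ - ∂₂v₁`. -/
def H1.rot : H1 Ω →L[ℝ] L2 Ω ℝ := (rotL.compLpL 2 (volume.restrict Ω)).comp H1.grad

/-- The norm `‖v‖₁ = (‖v‖² + ‖ε(v)‖²)^{1/2}`. -/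
def H1.norm1 (v : H1 Ω) : ℝ := √(‖H1.val v‖ ^ 2 + ‖H1.strain v‖ ^ 2)

/-- The function `z` itself. -/
def H1T.val : H1T Ω K →L[ℝ] L2 Ω ℝ := (WithLp.fstL 2 ℝ _ _).comp (H1T Ω K).subtypeL

/-- The piecewise `curl z = (∇z)^⊥`. -/
def H1T.curl : H1T Ω K →L[ℝ] L2 Ω Vec :=
  (perpL.compLpL 2 (volume.restrict Ω)).comp ((WithLp.sndL 2 ℝ _ _).comp (H1T Ω K).subtypeL)

/-- The tensor `τ` itself. -/
def HdivT.val : HdivT Ω K →L[ℝ] L2 Ω Mat := (WithLp.fstL 2 ℝ _ _).comp (HdivT Ω K).subtypeL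

/-- The piecewise divergence `div_𝒯 τ`. -/
def HdivT.div : HdivT Ω K →L[ℝ] L2 Ω Vec := (WithLp.sndL 2 ℝ _ _).comp (HdivT Ω K).subtypeL

end operators

/-! ### Boundary traces of `H¹` functions -/

/-- `g ∈ L₂(Γ; ℝ²)` is the trace of `v ∈ H¹(Ω; ℝ²)` on the boundary `Γ` of `Ω`, i.e., Green's formula
`∫_Ω ∇v : Ψ + ∫_Ω v · div Ψ = ∫_Γ g · (Ψ n)` holds for all smooth tensor fields `Ψ`
(`Γ` carries the arc length). -/
def IsTrace {Ω : Set Vec} (v : H1 Ω) (g : Vec → Vec) : Prop :=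
  MemLp g 2 ((Measure.hausdorffMeasure 1).restrict (frontier Ω)) ∧
  ∀ Ψ : Vec → Mat, ContDiff ℝ ∞ Ψ →
    (∫ x in Ω, ∑ i, ∑ j, H1.grad v x (i, j) * Ψ x (i, j)) +
      (∫ x in Ω, ∑ i, ∑ j, H1.val v x i * pd j (fun y => Ψ y (i, j)) x) =
    ∫ x in frontier Ω, ∑ i, ∑ j, g x i * Ψ x (i, j) * outerNormal Ω x j
      ∂(Measure.hausdorffMeasure 1)

/-- `H¹₀(Ω; ℝ²)`: the `H¹` functions with zero trace. -/
def H10 (Ω : Set Vec) : Set (H1 Ω) := {v | IsTrace v (fun _ => 0)}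

/-- `H¹_D(Ω; ℝ²)`: the `H¹` functions `v` with `v = 0` on `Γhc`, `v · n = 0` on `Γsc`, and `v · t = 0`
on `Γss`, in the sense of traces. -/
def H1D (Ω Γhc Γsc Γss : Set Vec) : Set (H1 Ω) :=
  {v | ∃ g, IsTrace v g ∧
    (∀ᵐ x ∂((Measure.hausdorffMeasure 1).restrict Γhc), g x = 0) ∧
    (∀ᵐ x ∂((Measure.hausdorffMeasure 1).restrict Γsc), inner ℝ (g x) (outerNormal Ω x) = 0) ∧
    (∀ᵐ x ∂((Measure.hausdorffMeasure 1).restrict Γss),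
      inner ℝ (g x) (perpL (outerNormal Ω x)) = 0)}

/-! ### Trace operators on the skeleton and normal-normal continuous tensors -/

section traces

variable (Ω : Set Vec) (K : Geometry.SimplicialComplex ℝ Vec)

/-- The canonical trace operator `γ : H¹(Ω; ℝ²) → H(div, 𝒯; 𝕊)*`,
`⟨γ(v), τ⟩ = (ε(v), τ) + (v, div_𝒯 τ)`. -/
def gammaTr : H1 Ω →ₗ[ℝ] StrongDual ℝ (HdivT Ω K) where
  toFun v := (innerSL ℝ (H1.strain v)).comp HdivT.val + (innerSL ℝ (H1.val v)).comp HdivT.div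
  map_add' v w := by ext τ; simp; ring
  map_smul' c v := by ext τ; simp

/-- The tangential trace operator `γ_t : H¹(Ω; ℝ²) → H¹(𝒯)*`,
`⟨γ_t(v), z⟩ = (rot v, z) - (v, curl_𝒯 z)`. -/
def gammaT : H1 Ω →ₗ[ℝ] StrongDual ℝ (H1T Ω K) where
  toFun v := (innerSL ℝ (H1.rot v)).comp H1T.val - (innerSL ℝ (H1.val v)).comp H1T.curl
  map_add' v w := by ext τ; simp; ring
  map_smul' c v := by ext τ; simp; ring

/-- `H̃^{1/2}_{0,n}(𝒮; ℝ²) = γ(ker γ_t ∩ H¹₀(Ω; ℝ²))`. -/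
def Htilde0n : Set (StrongDual ℝ (HdivT Ω K)) :=
  gammaTr Ω K '' ((LinearMap.ker (gammaT Ω K) : Set (H1 Ω)) ∩ H10 Ω)

/-- `H_nn(div, 𝒯; 𝕊)`: the tensors in `H(div, 𝒯; 𝕊)` with continuous normal-normal traces, normed
by `‖·‖_{div,𝒯}`. -/
def Hnn : Submodule ℝ (HdivT Ω K) where
  carrier := {τ | ∀ φ ∈ Htilde0n Ω K, φ τ = 0}
  zero_mem' := fun φ _ => map_zero φ
  add_mem' := fun ha hb φ hφ => by rw [map_add, ha φ hφ, hb φ hφ, add_zero]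
  smul_mem' := fun c _ ha φ hφ => by rw [map_smul, ha φ hφ, smul_zero]

/-- The trace operator `γ_{1,nn} : H¹(Ω; ℝ²) → H_nn(div, 𝒯; 𝕊)*`: the functional `γ(v)` restricted to
`H_nn(div, 𝒯; 𝕊)`. -/
def gammaNN : H1 Ω →ₗ[ℝ] StrongDual ℝ (Hnn Ω K) where
  toFun v := (gammaTr Ω K v).comp (Hnn Ω K).subtypeL
  map_add' v w := by ext τ; simp
  map_smul' c v := by ext τ; simp

/-- `H^{1/2}_t(𝒮; ℝ²) = γ_{1,nn}(H¹(Ω; ℝ²))`. -/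
def Ht : Set (StrongDual ℝ (Hnn Ω K)) := Set.range (gammaNN Ω K)

/-- `H^{1/2}_{D,t}(𝒮; ℝ²) = γ_{1,nn}(H¹_D(Ω; ℝ²))`. -/
def HDt (Γhc Γsc Γss : Set Vec) : Set (StrongDual ℝ (Hnn Ω K)) :=
  gammaNN Ω K '' H1D Ω Γhc Γsc Γss

variable {Ω K}

/-- The minimal extension norm `‖ρ‖_{1/2,t,𝒮} = inf {‖v‖₁ : γ_{1,nn}(v) = ρ}`. -/
def minExtNorm (ρ : StrongDual ℝ (Hnn Ω K)) : ℝ :=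
  sInf {r | ∃ v : H1 Ω, gammaNN Ω K v = ρ ∧ r = H1.norm1 v}

end traces

end Elast

end

open Elast

/-!
Map `v ∈ H¹(Ω; ℝ²)` to the pair `(ε(v), v)` in `L₂(Ω; ℝ²ˣ²) × L₂(Ω; ℝ²)`. The minimal extension
norm of `γ_{1,nn}(v)` is the distance of this pair to the image `N` of `ker γ_{1,nn}`, while its
dual norm is the norm of the pairing with `(ε(v), v)` on `H_nn(div, 𝒯; 𝕊)`, embedded by
`τ ↦ (τ, div_𝒯 τ)`. The two agree because the image of `H_nn` consists of all pairs with symmetric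
first component orthogonal to `N`: testing with the fields `φ eᵢ`, where `φ` is a test function
on a triangle, shows that the second component of such a pair is the divergence of the first.

If `v` is clamped in normal direction, the divergence theorem makes `γ_{1,nn}(v)` vanish on the
identity tensor, so restricting it to the orthogonal complement of the identity, the tensors whose
trace has integral zero, does not change its norm.
-/

noncomputable section

namespace Elast

section duality

variable {𝕜 E F G : Type*} [RCLike 𝕜] [NormedAddCommGroup E] [InnerProductSpace 𝕜 E]

lemma isLUB_apply_div_norm [NormedAddCommGroup F] [NormedSpace ℝ F] [Nontrivial F]
    (f : StrongDual ℝ F) : IsLUB {r : ℝ | ∃ x : F, x ≠ 0 ∧ r = f x / ‖x‖} ‖f‖ := by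
  refine ⟨?_, fun b hb => ?_⟩
  · rintro _ ⟨x, -, rfl⟩
    exact (le_abs_self _).trans ((abs_div _ _).trans_le (by simpa using f.ratio_le_opNorm x))
  have hle (x : F) : f x ≤ b * ‖x‖ := by
    obtain rfl | hx := eq_or_ne x 0
    · simp
    · exact (div_le_iff₀ (norm_pos_iff.2 hx)).1 (hb ⟨x, hx, rfl⟩)
  have habs (x : F) : |f x| ≤ b * ‖x‖ :=
    abs_le'.2 ⟨hle x, by simpa using hle (-x)⟩
  obtain ⟨x, hx⟩ := exists_ne (0 : F)
  have hb₀ : 0 ≤ b := nonneg_of_mul_nonneg_left ((abs_nonneg _).trans (habs x)) (norm_pos_iff.2 hx)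
  exact f.opNorm_le_bound hb₀ habs

lemma norm_comp_orthogonal_subtypeL [SeminormedAddCommGroup G] [NormedSpace 𝕜 G]
    (U : Submodule 𝕜 E) [U.HasOrthogonalProjection] {f : E →L[𝕜] G} (hf : ∀ x ∈ U, f x = 0) :
    ‖f.comp Uᗮ.subtypeL‖ = ‖f‖ := by
  refine le_antisymm ?_ (f.opNorm_le_bound (norm_nonneg _) fun x => ?_)
  · exact (f.opNorm_comp_le _).trans (mul_le_of_le_one_right (norm_nonneg _) Uᗮ.norm_subtypeL_le)
  · have hx : f x = f.comp Uᗮ.subtypeL (Uᗮ.orthogonalProjectionOnto x) := by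
      conv_lhs => rw [← U.starProjection_add_starProjection_orthogonal x]
      rw [map_add, hf _ (U.starProjection_apply_mem x), zero_add]
      rfl
    rw [hx]
    exact (ContinuousLinearMap.le_opNorm _ _).trans
      (mul_le_mul_of_nonneg_left (Uᗮ.norm_orthogonalProjectionOnto_apply_le x) (norm_nonneg _))

lemma isLUB_apply_div_norm_orthogonal [NormedAddCommGroup F] [InnerProductSpace ℝ F]
    (U : Submodule ℝ F) [U.HasOrthogonalProjection] (hU : Uᗮ ≠ ⊥) {f : StrongDual ℝ F}
    (hf : ∀ x ∈ U, f x = 0) :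
    IsLUB {r : ℝ | ∃ x : F, x ≠ 0 ∧ x ∈ Uᗮ ∧ r = f x / ‖x‖} ‖f‖ := by
  have : Nontrivial Uᗮ := (Submodule.nontrivial_iff_ne_bot).2 hU
  rw [← norm_comp_orthogonal_subtypeL U hf]
  convert isLUB_apply_div_norm (f.comp Uᗮ.subtypeL) using 3 with r
  simp

lemma isLUB_apply_div_norm_of_inner_eq_zero [NormedAddCommGroup F] [InnerProductSpace ℝ F]
    {a x₀ : F} (hx₀ : x₀ ≠ 0) (hax₀ : inner ℝ a x₀ = 0) {f : StrongDual ℝ F} (hfa : f a = 0) :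
    IsLUB {r : ℝ | ∃ x : F, x ≠ 0 ∧ inner ℝ a x = 0 ∧ r = f x / ‖x‖} ‖f‖ := by
  have hbot : (ℝ ∙ a)ᗮ ≠ ⊥ :=
    (Submodule.ne_bot_iff _).2 ⟨x₀, Submodule.mem_orthogonal_singleton_iff_inner_right.2 hax₀, hx₀⟩
  have hf : ∀ x ∈ ℝ ∙ a, f x = 0 := by
    intro x hx
    obtain ⟨c, rfl⟩ := Submodule.mem_span_singleton.1 hx
    rw [map_smul, hfa, smul_zero]
  simpa only [Submodule.mem_orthogonal_singleton_iff_inner_right] using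
    isLUB_apply_div_norm_orthogonal (ℝ ∙ a) hbot hf

lemma norm_innerSL_comp_eq_infDist [CompleteSpace E] [SeminormedAddCommGroup F]
    [NormedSpace 𝕜 F] {N S : Submodule 𝕜 E} (hNS : N ≤ S) (hS : IsClosed (S : Set E))
    {j : F →ₗᵢ[𝕜] E}
    (hj : range j = (S ⊓ Nᗮ : Submodule 𝕜 E)) {x : E} (hx : x ∈ S) :
    ‖(innerSL 𝕜 x).comp j.toContinuousLinearMap‖ = infDist x N := by
  set M := N.topologicalClosure
  have : CompleteSpace M := N.isClosed_topologicalClosure.completeSpace_coe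
  set q := x - M.starProjection x with hq
  have hqM : q ∈ Mᗮ := M.sub_starProjection_mem_orthogonal x
  have hPx : M.starProjection x ∈ M := M.starProjection_apply_mem x
  apply le_antisymm
  · refine (le_infDist ⟨0, N.zero_mem⟩).2 fun y hy => ?_
    refine ContinuousLinearMap.opNorm_le_bound _ dist_nonneg fun t => ?_
    have ht : j t ∈ S ⊓ Nᗮ := hj.le ⟨t, rfl⟩
    calc ‖inner 𝕜 x (j t)‖ = ‖inner 𝕜 (x - y) (j t)‖ := by
          rw [inner_sub_left, Submodule.inner_right_of_mem_orthogonal hy ht.2, sub_zero]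
      _ ≤ dist x y * ‖t‖ := by
          rw [dist_eq_norm, ← j.norm_map t]
          exact norm_inner_le_norm _ _
  · have hqS : q ∈ S := sub_mem hx (N.topologicalClosure_minimal hNS hS hPx)
    have hqN : q ∈ Nᗮ := Submodule.orthogonal_le N.le_topologicalClosure hqM
    obtain ⟨t, ht⟩ : q ∈ range j := hj.ge ⟨hqS, hqN⟩
    have hxq : inner 𝕜 x q = inner 𝕜 q q := by
      rw [hq, inner_sub_left x, Submodule.inner_right_of_mem_orthogonal hPx hqM, sub_zero]
    calc infDist x N = infDist x M := infDist_closure.symm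
      _ ≤ ‖q‖ := (infDist_le_dist_of_mem hPx).trans_eq (dist_eq_norm _ _)
      _ = ‖inner 𝕜 x (j t)‖ / ‖t‖ := by
          rw [← j.norm_map t, ht, hxq, inner_self_eq_norm_sq_to_K, norm_pow, RCLike.norm_ofReal,
            abs_norm, pow_two, mul_self_div_self]
      _ ≤ ‖(innerSL 𝕜 x).comp j.toContinuousLinearMap‖ :=
          ((innerSL 𝕜 x).comp j.toContinuousLinearMap).ratio_le_opNorm t

lemma infDist_map_ker {R V W E : Type*} [Semiring R] [AddCommGroup V] [Module R V]
    [AddCommMonoid W] [Module R W] [SeminormedAddCommGroup E] [Module R E] (f : V →ₗ[R] W)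
    (j : V →ₗ[R] E) (v : V) :
    infDist (j v) ((LinearMap.ker f).map j) = sInf {r | ∃ w, f w = f v ∧ r = ‖j w‖} := by
  have hdist (w : V) : dist (j v) (j w) = ‖j (v - w)‖ := by rw [dist_eq_norm, map_sub]
  rw [infDist_eq_iInf, ← sInf_image', Submodule.map_coe, image_image]
  congr 1
  ext r
  constructor
  · rintro ⟨w, hw, rfl⟩
    refine ⟨v - w, ?_, hdist w⟩
    rw [← zero_add (f (v - w)), ← LinearMap.mem_ker.1 hw, ← map_add, add_sub_cancel]
  · rintro ⟨w, hw, rfl⟩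
    refine ⟨v - w, LinearMap.mem_ker.2 ?_, (hdist _).trans (by rw [sub_sub_cancel])⟩
    rw [sub_eq_add_neg, map_add, ← hw, ← map_add, add_neg_cancel, map_zero]

end duality

section traces

variable {Ω U : Set Vec} {K : Geometry.SimplicialComplex ℝ Vec}

/-- The Hilbert space `L₂(Ω; ℝ²ˣ²) × L₂(Ω; ℝ²)` in which `H(div, 𝒯; 𝕊)` is embedded by
`τ ↦ (τ, div_𝒯 τ)`. -/
abbrev TensorPair (Ω : Set Vec) : Type := WithLp 2 (L2 Ω Mat × L2 Ω Vec)

lemma symL_apply (A : Mat) (i j : Fin 2) : symL A (i, j) = 1 / 2 * (A (i, j) + A (j, i)) := rfl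

lemma inner_eq_sum_mul {ι : Type*} [Fintype ι] (x y : EuclideanSpace ℝ ι) :
    inner ℝ x y = ∑ i, x i * y i := by
  simp [PiLp.inner_apply, mul_comm]

lemma inner_symL_left (A B : Mat) : inner ℝ (symL A) B = inner ℝ A (symL B) := by
  simp only [inner_eq_sum_mul, Fintype.sum_prod_type, Fin.sum_univ_two, symL_apply]
  ring

lemma symL_eq_self_iff {A : Mat} : symL A = A ↔ ∀ i j, A (i, j) = A (j, i) := by
  refine ⟨fun h i j => ?_, fun h => ?_⟩
  · rw [← h, symL_apply, symL_apply, add_comm]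
  · ext ⟨i, j⟩
    rw [symL_apply, h j i]
    ring

lemma symL_symL (A : Mat) : symL (symL A) = symL A :=
  symL_eq_self_iff.2 fun i j => by rw [symL_apply, symL_apply, add_comm]

/-- The pairs `(τ, u)` with `τ` pointwise symmetric, as the fixed points of the projection onto the
symmetric part. -/
def symmPairs (Ω : Set Vec) : Submodule ℝ (TensorPair Ω) :=
  LinearMap.eqLocus ((symL.compLpL 2 (volume.restrict Ω)).comp (WithLp.fstL 2 ℝ _ _)).toLinearMap
    (WithLp.fstL 2 ℝ (L2 Ω Mat) (L2 Ω Vec)).toLinearMap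

lemma isClosed_symmPairs : IsClosed (symmPairs Ω : Set (TensorPair Ω)) :=
  isClosed_eq ((symL.compLpL 2 (volume.restrict Ω)).comp (WithLp.fstL 2 ℝ _ _)).continuous
    (WithLp.fstL 2 ℝ (L2 Ω Mat) (L2 Ω Vec)).continuous

lemma mem_symmPairs_iff {p : TensorPair Ω} :
    p ∈ symmPairs Ω ↔ ∀ᵐ x ∂(volume.restrict Ω), symL (p.fst x) = p.fst x := by
  have h := symL.coeFn_compLpL (p := 2) (μ := volume.restrict Ω) p.fst
  change symL.compLpL 2 (volume.restrict Ω) p.fst = p.fst ↔ _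
  rw [Lp.ext_iff]
  exact ⟨fun hp => h.symm.trans hp, fun hp => h.trans hp⟩

/-- The pair `(ε(v), v)`, which represents the functional `γ(v)`. -/
def H1.strainPair : H1 Ω →L[ℝ] TensorPair Ω :=
  ((WithLp.prodContinuousLinearEquiv 2 ℝ (L2 Ω Mat) (L2 Ω Vec)).symm :
    (L2 Ω Mat × L2 Ω Vec) →L[ℝ] TensorPair Ω).comp (H1.strain.prod H1.val)

lemma H1.norm_strainPair (v : H1 Ω) : ‖H1.strainPair v‖ = H1.norm1 v := by
  rw [WithLp.prod_norm_eq_of_L2, H1.norm1, add_comm]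
  rfl

lemma H1.strain_ae (v : H1 Ω) :
    ∀ᵐ x ∂(volume.restrict Ω), H1.strain v x = symL (H1.grad v x) :=
  symL.coeFn_compLpL (p := 2) (μ := volume.restrict Ω) (H1.grad v)

lemma H1.strainPair_mem_symmPairs (v : H1 Ω) : H1.strainPair v ∈ symmPairs Ω := by
  rw [mem_symmPairs_iff]
  filter_upwards [H1.strain_ae v] with x hx
  change symL (H1.strain v x) = H1.strain v x
  rw [hx, symL_symL]

lemma inner_strainPair (v : H1 Ω) {p : TensorPair Ω} (hp : p ∈ symmPairs Ω) :
    inner ℝ (H1.strainPair v) p =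
      (∫ x in Ω, ∑ i, ∑ j, H1.grad v x (i, j) * p.fst x (i, j)) +
        ∫ x in Ω, ∑ i, H1.val v x i * p.snd x i := by
  have hstrain : inner ℝ (H1.strain v) p.fst =
      ∫ x in Ω, ∑ i, ∑ j, H1.grad v x (i, j) * p.fst x (i, j) := by
    rw [L2.inner_def]
    apply integral_congr_ae
    filter_upwards [H1.strain_ae v, mem_symmPairs_iff.1 hp] with x hv hx
    rw [hv, inner_symL_left, hx, inner_eq_sum_mul, Fintype.sum_prod_type]
  have hval : inner ℝ (H1.val v) p.snd = ∫ x in Ω, ∑ i, H1.val v x i * p.snd x i := by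
    simp only [L2.inner_def, inner_eq_sum_mul]
  rw [WithLp.prod_inner_apply, ← hstrain, ← hval]
  rfl

/-- The isometric embedding `τ ↦ (τ, div_𝒯 τ)` of `H_nn(div, 𝒯; 𝕊)`. -/
def Hnn.toPair : Hnn Ω K →ₗᵢ[ℝ] TensorPair Ω :=
  (HdivT Ω K).subtypeₗᵢ.comp (Hnn Ω K).subtypeₗᵢ

lemma Hnn.toPair_mem_symmPairs (τ : Hnn Ω K) : Hnn.toPair τ ∈ symmPairs Ω :=
  mem_symmPairs_iff.2 <| (τ : HdivT Ω K).2.1.mono fun _ => symL_eq_self_iff.2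

lemma gammaTr_apply (v : H1 Ω) (τ : HdivT Ω K) :
    gammaTr Ω K v τ = inner ℝ (H1.strainPair v) (τ : TensorPair Ω) := by
  rw [WithLp.prod_inner_apply]
  rfl

lemma gammaNN_apply (v : H1 Ω) (τ : Hnn Ω K) :
    gammaNN Ω K v τ = inner ℝ (H1.strainPair v) (Hnn.toPair τ) :=
  gammaTr_apply v _

lemma gammaNN_eq_innerSL_comp (v : H1 Ω) :
    gammaNN Ω K v =
      (innerSL ℝ (H1.strainPair v)).comp (Hnn.toPair (K := K)).toContinuousLinearMap :=
  ContinuousLinearMap.ext (gammaNN_apply v)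

lemma minExtNorm_gammaNN (v : H1 Ω) :
    minExtNorm (gammaNN Ω K v) =
      infDist (H1.strainPair v) ((LinearMap.ker (gammaNN Ω K)).map H1.strainPair.toLinearMap) := by
  simp only [minExtNorm, ← H1.norm_strainPair]
  exact (infDist_map_ker (gammaNN Ω K) H1.strainPair.toLinearMap v).symm

lemma pd_eq_zero_of_notMem_tsupport {φ : Vec → ℝ} {x : Vec} (hx : x ∉ tsupport φ) (j : Fin 2) :
    pd j φ x = 0 := by
  rw [pd, fderiv_of_notMem_tsupport (𝕜 := ℝ) hx, zero_apply]

lemma integral_mul_pd {φ ψ : Vec → ℝ} (hφ : ContDiff ℝ 1 φ) (hψ : ContDiff ℝ 1 ψ)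
    (hψc : HasCompactSupport ψ) (j : Fin 2) :
    ∫ x, φ x * pd j ψ x = - ∫ x, pd j φ x * ψ x := by
  have hφ' : Continuous (pd j φ) := (hφ.continuous_fderiv one_ne_zero).clm_apply continuous_const
  have hψ' : Continuous (pd j ψ) := (hψ.continuous_fderiv one_ne_zero).clm_apply continuous_const
  have hψc' : HasCompactSupport (pd j ψ) := hψc.fderiv_apply (𝕜 := ℝ) _
  exact integral_mul_fderiv_eq_neg_fderiv_mul_of_integrable
    ((hφ'.mul hψ.continuous).integrable_of_hasCompactSupport hψc.mul_left)
    ((hφ.continuous.mul hψ').integrable_of_hasCompactSupport hψc'.mul_left)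
    ((hφ.continuous.mul hψ.continuous).integrable_of_hasCompactSupport hψc.mul_left)
    (fun x _ => hφ.differentiable one_ne_zero x) (fun x _ => hψ.differentiable one_ne_zero x)

lemma isWeakPartial_of_contDiff {φ : Vec → ℝ} (hφ : ContDiff ℝ 1 φ) (hU : U ≤ᵐ[volume] Ω)
    (j : Fin 2) : IsWeakPartial Ω U j φ (pd j φ) := by
  intro ψ hψ
  have hψ₀ : ∀ᵐ x, x ∉ Ω → x ∉ tsupport ψ := by
    filter_upwards [hU] with x hx hxΩ hxψ using hxΩ (hx (hψ.2.2 hxψ))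
  rw [setIntegral_eq_integral_of_ae_compl_eq_zero, setIntegral_eq_integral_of_ae_compl_eq_zero]
  · exact integral_mul_pd hφ (hψ.1.of_le (by simp)) hψ.2.1 j
  · filter_upwards [hψ₀] with x hx hxΩ
    rw [image_eq_zero_of_notMem_tsupport (hx hxΩ), mul_zero]
  · filter_upwards [hψ₀] with x hx hxΩ
    rw [pd_eq_zero_of_notMem_tsupport (hx hxΩ), mul_zero]

lemma IsTest.setIntegral_pd_eq_zero {φ : Vec → ℝ} (hφ : IsTest U φ) (hU : U ≤ᵐ[volume] Ω)
    (j : Fin 2) : ∫ x in Ω, pd j φ x = 0 := by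
  simpa [pd] using isWeakPartial_of_contDiff (contDiff_const (c := (1 : ℝ))) hU j φ hφ

lemma exists_H1_single {φ : Vec → ℝ} (hφ : IsTest U φ) (i : Fin 2) :
    ∃ w : H1 Ω,
      (∀ᵐ x ∂(volume.restrict Ω), ∀ k, H1.val w x k = if k = i then φ x else 0) ∧
      ∀ᵐ x ∂(volume.restrict Ω), ∀ k j, H1.grad w x (k, j) = if k = i then pd j φ x else 0 := by
  have hval : MemLp (fun x => EuclideanSpace.single i (φ x) : Vec → Vec) 2 (volume.restrict Ω) :=
    MemLp.of_eval_piLp fun k => by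
      by_cases hk : k = i <;> simp [hk, hφ.memLp]
  have hgrad : MemLp
      (fun x => WithLp.toLp 2 fun p => if p.1 = i then pd p.2 φ x else 0 : Vec → Mat) 2
      (volume.restrict Ω) :=
    MemLp.of_eval_piLp fun p => by
      by_cases hp : p.1 = i <;> simp [hp, hφ.memLp_pd]
  have hv : ∀ᵐ x ∂(volume.restrict Ω), ∀ k, hval.toLp _ x k = if k = i then φ x else 0 := by
    filter_upwards [hval.coeFn_toLp] with x hx k
    simp [hx]
  have hg : ∀ᵐ x ∂(volume.restrict Ω), ∀ k j,
      hgrad.toLp _ x (k, j) = if k = i then pd j φ x else 0 := by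
    filter_upwards [hgrad.coeFn_toLp] with x hx k j
    simp [hx]
  refine ⟨⟨WithLp.toLp 2 (hval.toLp _, hgrad.toLp _), fun k j => ?_⟩, hv, hg⟩
  have hpartial : IsWeakPartial Ω Ω j (fun x => if k = i then φ x else 0)
      fun x => if k = i then pd j φ x else 0 := by
    by_cases hk : k = i
    · simpa [hk] using isWeakPartial_of_contDiff (hφ.1.of_le (by simp)) Filter.EventuallyLE.rfl j
    · simpa [hk] using IsWeakPartial.zero
  exact hpartial.congr (hv.mono fun x hx => hx k) (hg.mono fun x hx => hx k j)

lemma exists_H1_forall_inner_strainPair_eq {φ : Vec → ℝ} (hφ : IsTest U φ) (i : Fin 2) :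
    ∃ w : H1 Ω, ∀ p ∈ symmPairs Ω, inner ℝ (H1.strainPair w) p =
      (∫ x in Ω, ∑ j, p.fst x (i, j) * pd j φ x) + ∫ x in Ω, p.snd x i * φ x := by
  obtain ⟨w, hval, hgrad⟩ := exists_H1_single (Ω := Ω) hφ i
  refine ⟨w, fun p hp => ?_⟩
  rw [inner_strainPair w hp]
  congr 1 <;> apply integral_congr_ae
  · filter_upwards [hgrad] with x hx
    rw [Finset.sum_comm]
    simp [hx, mul_comm]
  · filter_upwards [hval] with x hx
    simp [hx, mul_comm]

lemma Hnn.range_toPair :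
    range (Hnn.toPair (Ω := Ω) (K := K)) =
      (symmPairs Ω ⊓ ((LinearMap.ker (gammaNN Ω K)).map H1.strainPair.toLinearMap)ᗮ :
        Submodule ℝ (TensorPair Ω)) := by
  refine le_antisymm ?_ fun q ⟨hsymm, hker⟩ => ?_
  · rintro _ ⟨τ, rfl⟩
    refine ⟨Hnn.toPair_mem_symmPairs τ, (Submodule.mem_orthogonal _ _).2 ?_⟩
    rintro _ ⟨w, hw, rfl⟩
    exact (gammaNN_apply w τ).symm.trans (DFunLike.congr_fun (LinearMap.mem_ker.1 hw) τ)
  have hq (w : H1 Ω) (hw : gammaNN Ω K w = 0) : inner ℝ (H1.strainPair w) q = 0 :=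
    Submodule.inner_right_of_mem_orthogonal (Submodule.mem_map_of_mem hw) hker
  have hqdiv : q ∈ HdivT Ω K := by
    refine ⟨(mem_symmPairs_iff.1 hsymm).mono fun _ => symL_eq_self_iff.1, fun T hT i φ hφ => ?_⟩
    obtain ⟨w, hw⟩ := exists_H1_forall_inner_strainPair_eq (Ω := Ω) hφ i
    have hwker : gammaNN Ω K w = 0 := by
      ext τ
      rw [gammaNN_apply]
      exact (hw _ (Hnn.toPair_mem_symmPairs τ)).trans
        (eq_neg_iff_add_eq_zero.1 ((τ : HdivT Ω K).2.2 T hT i φ hφ))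
    exact eq_neg_iff_add_eq_zero.2 ((hw q hsymm).symm.trans (hq w hwker))
  refine ⟨⟨⟨q, hqdiv⟩, ?_⟩, rfl⟩
  rintro _ ⟨w, hw, rfl⟩
  exact (gammaTr_apply _ _).trans (hq w (ContinuousLinearMap.ext fun τ => τ.2 _ ⟨w, hw, rfl⟩))

lemma norm_gammaNN (v : H1 Ω) :
    ‖gammaNN Ω K v‖ =
      infDist (H1.strainPair v) ((LinearMap.ker (gammaNN Ω K)).map H1.strainPair.toLinearMap) := by
  have hsymm : (LinearMap.ker (gammaNN Ω K)).map H1.strainPair.toLinearMap ≤ symmPairs Ω := by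
    rintro _ ⟨w, -, rfl⟩
    exact H1.strainPair_mem_symmPairs w
  rw [gammaNN_eq_innerSL_comp]
  exact norm_innerSL_comp_eq_infDist (F := Hnn Ω K) hsymm isClosed_symmPairs
    (Hnn.range_toPair (K := K)) (H1.strainPair_mem_symmPairs v)

theorem minExtNorm_eq_norm {ρ : StrongDual ℝ (Hnn Ω K)} (hρ : ρ ∈ Ht Ω K) :
    minExtNorm ρ = ‖ρ‖ := by
  obtain ⟨v, rfl⟩ := hρ
  rw [minExtNorm_gammaNN, norm_gammaNN]

set_option maxSynthPendingDepth 3 in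
theorem isLUB_minExtNorm [Nontrivial (Hnn Ω K)] {ρ : StrongDual ℝ (Hnn Ω K)} (hρ : ρ ∈ Ht Ω K) :
    IsLUB {r : ℝ | ∃ τ : Hnn Ω K, τ ≠ 0 ∧ r = ρ τ / ‖τ‖} (minExtNorm ρ) := by
  rw [minExtNorm_eq_norm hρ]
  exact isLUB_apply_div_norm (F := Hnn Ω K) ρ

end traces

section constants

variable {Ω : Set Vec} {K : Geometry.SimplicialComplex ℝ Vec}

lemma IsTrace.integral_inner_grad {v : H1 Ω} {g : Vec → Vec} (hg : IsTrace v g) (A : Mat) :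
    ∫ x in Ω, inner ℝ A (H1.grad v x) =
      ∫ x in frontier Ω, ∑ i, ∑ j, g x i * A (i, j) * outerNormal Ω x j
        ∂(Measure.hausdorffMeasure 1) := by
  simpa [pd, inner_eq_sum_mul, Fintype.sum_prod_type, mul_comm] using
    hg.2 (fun _ => A) contDiff_const

/-- The diagonal tensor with diagonal `a`; the identity tensor is `diagMat 1`. -/
def diagMat (a : Fin 2 → ℝ) : Mat := WithLp.toLp 2 fun p => Matrix.diagonal a p.1 p.2

lemma symL_diagMat (a : Fin 2 → ℝ) : symL (diagMat a) = diagMat a :=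
  symL_eq_self_iff.2 fun i j => congrFun₂ (Matrix.diagonal_transpose a).symm i j

lemma inner_diagMat_diagMat (a b : Fin 2 → ℝ) :
    inner ℝ (diagMat a) (diagMat b) = ∑ i, a i * b i := by
  simp [inner_eq_sum_mul, Fintype.sum_prod_type, diagMat]

lemma inner_diagMat_one (A : Mat) : inner ℝ (diagMat 1) A = trL A := by
  simp [inner_eq_sum_mul, Fintype.sum_prod_type, diagMat, trL]

lemma IsTrace.integral_trL_grad {v : H1 Ω} {g : Vec → Vec} (hg : IsTrace v g) :
    ∫ x in Ω, trL (H1.grad v x) =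
      ∫ x in frontier Ω, inner ℝ (g x) (outerNormal Ω x) ∂(Measure.hausdorffMeasure 1) := by
  simp only [← inner_diagMat_one, IsTrace.integral_inner_grad hg]
  simp [inner_eq_sum_mul, diagMat, Matrix.diagonal_apply]

lemma integral_trL_grad_eq_zero {Γhc Γsc Γss : Set Vec}
    (hΓ : Measure.hausdorffMeasure 1 (frontier Ω \ (Γhc ∪ Γsc)) = 0) {v : H1 Ω}
    (hv : v ∈ H1D Ω Γhc Γsc Γss) : ∫ x in Ω, trL (H1.grad v x) = 0 := by
  obtain ⟨g, hg, hhc, hsc, -⟩ := hv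
  rw [IsTrace.integral_trL_grad hg]
  apply integral_eq_zero_of_ae
  have hΓsub : frontier Ω ⊆ (Γhc ∪ Γsc) ∪ frontier Ω \ (Γhc ∪ Γsc) := by
    rw [union_sdiff_self]
    exact subset_union_right
  refine ae_restrict_of_ae_restrict_of_subset hΓsub ?_
  rw [ae_restrict_union_iff, ae_restrict_union_iff, Measure.restrict_eq_zero.2 hΓ]
  exact ⟨⟨hhc.mono fun x hx => by simp [hx], hsc⟩, by simp⟩

/-- The constant tensor field `A` paired with its divergence `0`. -/
def constPair (Ω : Set Vec) [IsFiniteMeasure (volume.restrict Ω)] (A : Mat) : TensorPair Ω :=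
  WithLp.toLp 2 (Lp.const 2 (volume.restrict Ω) A, 0)

variable [IsFiniteMeasure (volume.restrict Ω)]

lemma constPair_fst_ae (A : Mat) :
    ∀ᵐ x ∂(volume.restrict Ω), (constPair Ω A).fst x = A :=
  Lp.coeFn_const 2 (volume.restrict Ω) A

lemma inner_constPair_left (A : Mat) (p : TensorPair Ω) :
    inner ℝ (constPair Ω A) p = ∫ x in Ω, inner ℝ A (p.fst x) := by
  have h : inner ℝ (constPair Ω A) p = inner ℝ (constPair Ω A).fst p.fst := by
    rw [WithLp.prod_inner_apply]
    exact add_eq_left.2 (inner_zero_left p.snd)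
  rw [h, L2.inner_def]
  apply integral_congr_ae
  filter_upwards [constPair_fst_ae (Ω := Ω) A] with x hx
  rw [hx]

lemma constPair_mem_symmPairs {A : Mat} (hA : symL A = A) : constPair Ω A ∈ symmPairs Ω :=
  mem_symmPairs_iff.2 <| (constPair_fst_ae A).mono fun x hx => by rw [hx, hA]

lemma inner_constPair_strainPair {A : Mat} (hA : symL A = A) (v : H1 Ω) :
    inner ℝ (constPair Ω A) (H1.strainPair v) = ∫ x in Ω, inner ℝ A (H1.grad v x) := by
  rw [inner_constPair_left]
  apply integral_congr_ae
  filter_upwards [H1.strain_ae v] with x hx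
  change inner ℝ A (H1.strain v x) = _
  rw [hx, ← inner_symL_left, hA]

lemma constPair_mem_HdivT (hK : ∀ T ∈ openTriangles K, T ≤ᵐ[volume] Ω) {A : Mat}
    (hA : symL A = A) : constPair Ω A ∈ HdivT Ω K := by
  refine ⟨(mem_symmPairs_iff.1 (constPair_mem_symmPairs hA)).mono fun _ => symL_eq_self_iff.1,
    fun T hT i => ?_⟩
  have hdiv : IsWeakDiv Ω T (fun j _ => A (i, j)) fun _ => 0 := by
    intro φ hφ
    rw [integral_finsetSum _ fun j _ =>
      ((hφ.memLp_pd j).integrable one_le_two).const_mul (A (i, j))]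
    simp [integral_const_mul, hφ.setIntegral_pd_eq_zero (hK T hT)]
  refine hdiv.congr (fun j => ?_) (coord_zero i)
  filter_upwards [constPair_fst_ae (Ω := Ω) A] with x hx
  rw [hx]

/-- The constant symmetric tensor field `A`, as an element of `H_nn(div, 𝒯; 𝕊)`. -/
def Hnn.const (hK : ∀ T ∈ openTriangles K, T ≤ᵐ[volume] Ω) {A : Mat} (hA : symL A = A) :
    Hnn Ω K :=
  ⟨⟨constPair Ω A, constPair_mem_HdivT hK hA⟩, by
    rintro _ ⟨w, ⟨-, hw⟩, rfl⟩
    rw [gammaTr_apply, real_inner_comm, inner_constPair_strainPair hA,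
      IsTrace.integral_inner_grad hw]
    simp⟩

lemma gammaNN_const (hK : ∀ T ∈ openTriangles K, T ≤ᵐ[volume] Ω) {A : Mat} (hA : symL A = A)
    (v : H1 Ω) : gammaNN Ω K v (Hnn.const hK hA) = ∫ x in Ω, inner ℝ A (H1.grad v x) :=
  (gammaNN_apply v _).trans ((real_inner_comm _ _).trans (inner_constPair_strainPair hA v))

lemma Hnn.inner_const_left (hK : ∀ T ∈ openTriangles K, T ≤ᵐ[volume] Ω) {A : Mat}
    (hA : symL A = A) (τ : Hnn Ω K) :
    inner ℝ (Hnn.const hK hA) τ = ∫ x in Ω, inner ℝ A (HdivT.val (τ : HdivT Ω K) x) :=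
  inner_constPair_left A _

lemma Hnn.inner_const_const (hK : ∀ T ∈ openTriangles K, T ≤ᵐ[volume] Ω) {A B : Mat}
    (hA : symL A = A) (hB : symL B = B) :
    inner ℝ (Hnn.const hK hA) (Hnn.const hK hB) = volume.real Ω * inner ℝ A B := by
  have hint : ∫ x in Ω, inner ℝ A ((constPair Ω B).fst x) = ∫ _ in Ω, inner ℝ A B := by
    apply integral_congr_ae
    filter_upwards [constPair_fst_ae (Ω := Ω) B] with x hx
    rw [hx]
  rw [Hnn.inner_const_left]
  exact hint.trans (by simp)

lemma Hnn.inner_const_one_left (hK : ∀ T ∈ openTriangles K, T ≤ᵐ[volume] Ω) (τ : Hnn Ω K) :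
    inner ℝ (Hnn.const hK (symL_diagMat 1)) τ =
      ∫ x in Ω, trL (HdivT.val (τ : HdivT Ω K) x) := by
  simp only [Hnn.inner_const_left, inner_diagMat_one]

set_option maxSynthPendingDepth 3 in
lemma Hnn.exists_ne_zero_integral_trL_eq_zero (hK : ∀ T ∈ openTriangles K, T ≤ᵐ[volume] Ω)
    (hΩ : volume Ω ≠ 0) :
    ∃ τ : Hnn Ω K, τ ≠ 0 ∧ ∫ x in Ω, trL (HdivT.val (τ : HdivT Ω K) x) = 0 := by
  have hvol : volume.real Ω ≠ 0 := by
    rw [← measureReal_restrict_apply_univ, ne_eq, measureReal_eq_zero_iff,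
      Measure.restrict_apply_univ]
    exact hΩ
  refine ⟨Hnn.const hK (symL_diagMat ![1, -1]), fun h => ?_, ?_⟩
  · have hnorm := Hnn.inner_const_const hK (symL_diagMat ![1, -1]) (symL_diagMat ![1, -1])
    rw [h, inner_zero_left, inner_diagMat_diagMat] at hnorm
    simp [hvol] at hnorm
  · rw [← Hnn.inner_const_one_left hK, Hnn.inner_const_const, inner_diagMat_diagMat]
    simp

set_option maxSynthPendingDepth 3 in
theorem isLUB_minExtNorm_trace_free (hK : ∀ T ∈ openTriangles K, T ≤ᵐ[volume] Ω)
    (hΩ : volume Ω ≠ 0) {v : H1 Ω} (hv : ∫ x in Ω, trL (H1.grad v x) = 0) :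
    IsLUB {r : ℝ | ∃ τ : Hnn Ω K, τ ≠ 0 ∧
        ∫ x in Ω, trL (HdivT.val (τ : HdivT Ω K) x) = 0 ∧ r = gammaNN Ω K v τ / ‖τ‖}
      (minExtNorm (gammaNN Ω K v)) := by
  obtain ⟨τ₀, hτ₀, htr⟩ := Hnn.exists_ne_zero_integral_trL_eq_zero hK hΩ
  have hone : gammaNN Ω K v (Hnn.const hK (symL_diagMat 1)) = 0 := by
    simpa only [gammaNN_const, inner_diagMat_one] using hv
  rw [← Hnn.inner_const_one_left hK] at htr
  rw [minExtNorm_eq_norm ⟨v, rfl⟩]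
  have h := isLUB_apply_div_norm_of_inner_eq_zero (F := Hnn Ω K) hτ₀ htr hone
  simp only [Hnn.inner_const_one_left] at h
  exact h

end constants

section domain

variable {Ω Γhc Γsc Γss Γsf : Set Vec} {K : Geometry.SimplicialComplex ℝ Vec}

lemma addHaar_segment {E : Type*} [NormedAddCommGroup E] [NormedSpace ℝ E] [MeasurableSpace E]
    [BorelSpace E] [FiniteDimensional ℝ E] (μ : Measure E) [μ.IsAddHaarMeasure]
    (hE : 1 < Module.finrank ℝ E) (p q : E) : μ (segment ℝ p q) = 0 := by
  have hne : affineSpan ℝ {p, q} ≠ ⊤ := by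
    intro h
    have hrank := (collinear_pair ℝ p q).finrank_le_one
    rw [← direction_affineSpan, h, AffineSubspace.direction_top, finrank_top] at hrank
    exact hrank.not_gt hE
  rw [← convexHull_pair]
  exact measure_mono_null (convexHull_subset_affineSpan _)
    (Measure.addHaar_affineSubspace μ _ hne)

lemma IsPolygonalLipschitzDomain.volume_frontier (hΩ : IsPolygonalLipschitzDomain Ω) :
    volume (frontier Ω) = 0 := by
  obtain ⟨S, hS, hfrontier⟩ := hΩ.polygonal
  rw [hfrontier]
  exact (measure_biUnion_null_iff hS.countable).2 fun p _ =>
    addHaar_segment volume (by simp) p.1 p.2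

lemma IsTriangulation.openTriangle_ae_le (hK : IsTriangulation K Ω)
    (hΩ : IsPolygonalLipschitzDomain Ω) {T : Set Vec} (hT : T ∈ openTriangles K) :
    T ≤ᵐ[volume] Ω := by
  obtain ⟨s, hs, -, rfl⟩ := hT
  have hT : interior (convexHull ℝ (s : Set Vec)) ⊆ closure Ω :=
    (interior_subset.trans (K.convexHull_subset_space hs)).trans_eq hK.space_eq
  have hclosure : closure Ω =ᵐ[volume] Ω := by
    rw [closure_eq_self_union_frontier]
    exact union_ae_eq_left_of_ae_eq_empty (ae_eq_empty.2 hΩ.volume_frontier)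
  exact hT.eventuallyLE.trans hclosure.le

lemma IsBoundaryDecomposition.frontier_sdiff_null
    (hΓ : IsBoundaryDecomposition Ω Γhc Γsc Γss Γsf) (hs : Γss ∪ Γsf = ∅) :
    Measure.hausdorffMeasure 1 (frontier Ω \ (Γhc ∪ Γsc)) = 0 := by
  simpa only [union_assoc, hs, union_empty] using hΓ.null

end domain

end Elast

end

theorem proposition2p4_general {Ω : Set Vec} (hΩ₀ : volume Ω ≠ 0) (hΩ : volume Ω ≠ ⊤)
    {K : Geometry.SimplicialComplex ℝ Vec} (hK : ∀ T ∈ openTriangles K, T ≤ᵐ[volume] Ω) :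
    (∀ ρ ∈ Ht Ω K,
      IsLUB {r : ℝ | ∃ τ : Hnn Ω K, τ ≠ 0 ∧ r = ρ τ / ‖τ‖} (minExtNorm ρ)) ∧
    (∀ v : H1 Ω, ∫ x in Ω, trL (H1.grad v x) = 0 →
      IsLUB {r : ℝ | ∃ τ : Hnn Ω K, τ ≠ 0 ∧
          ∫ x in Ω, trL (HdivT.val (τ : HdivT Ω K) x) = 0 ∧ r = gammaNN Ω K v τ / ‖τ‖}
        (minExtNorm (gammaNN Ω K v))) := by
  have : IsFiniteMeasure (volume.restrict Ω) := isFiniteMeasure_restrict.2 hΩ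
  obtain ⟨τ₀, hτ₀, -⟩ := Hnn.exists_ne_zero_integral_trL_eq_zero hK hΩ₀
  have : Nontrivial (Hnn Ω K) := nontrivial_of_ne τ₀ 0 hτ₀
  exact ⟨fun _ => isLUB_minExtNorm, fun _ => isLUB_minExtNorm_trace_free hK hΩ₀⟩

theorem proposition2p4 (Ω : Set Vec) (hΩ : IsPolygonalLipschitzDomain Ω)
    (K : Geometry.SimplicialComplex ℝ Vec) (hK : IsTriangulation K Ω)
    (Γhc Γsc Γss Γsf : Set Vec) (hΓ : IsBoundaryDecomposition Ω Γhc Γsc Γss Γsf) :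
    (∀ ρ ∈ Ht Ω K,
      IsLUB {r : ℝ | ∃ τ : Hnn Ω K, τ ≠ 0 ∧ r = ρ τ / ‖τ‖} (minExtNorm ρ)) ∧
    (Γss ∪ Γsf = ∅ → ∀ ρ ∈ HDt Ω K Γhc Γsc Γss,
      IsLUB {r : ℝ | ∃ τ : Hnn Ω K, τ ≠ 0 ∧
          ∫ x in Ω, trL (HdivT.val (τ : HdivT Ω K) x) = 0 ∧ r = ρ τ / ‖τ‖}
        (minExtNorm ρ)) := by
  have h := proposition2p4_general (hΩ.isOpen.measure_ne_zero volume hΩ.isConnected.nonempty)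
    hΩ.isBounded.measure_lt_top.ne fun T => hK.openTriangle_ae_le hΩ
  refine ⟨h.1, ?_⟩
  rintro hs _ ⟨v, hv, rfl⟩
  exact h.2 v (integral_trL_grad_eq_zero (hΓ.frontier_sdiff_null hs) hv)
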